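/- For a linear polynomial $f=\sum_i a_ix_i+b$ over $\mathbb{Q}$, let $\mathrm{im}_2(f)$ be the set of values of $f$ under $0$-$1$ assignments to its variables; $f$ depends on $n$ variables if exactly $n$ of the coefficients $a_i$ are nonzero. A linear clause is a finite disjunction of distinct equations $g=0$ with $g$ a linear polynomial over $\mathbb{Q}$ (duplicates are contracted). A $\mathrm{Res}(\mathrm{lin}_{\mathbb{Q}})$ derivation from a set $\phi$ of linear clauses is a finite sequence of linear clauses, each of which belongs to $\phi$, is a boolean axiom $x_i=0\vee x_i=1$, or follows from earlier clauses by one of the rules: resolution (from $C\vee g=0$ and $D\vee h=0$ derive $C\vee D\vee \alpha g+\beta h=0$, where $\alpha,\beta\in\mathbb{Q}$), simplification (from $C\vee a=0$ with a constant $0\ne a\in\mathbb{Q}$ derive $C$), and weakening (from $C$ derive $C\vee g=0$). A refutation is a derivation of the empty clause. It is tree-like if every line of the sequence is used at most once as a premise of a rule. The size of a derivation is the sum over its clauses of the number of occurrences of variables plus the total binary size of the coefficients (constant terms included). **Theorem (Subset-sum tree-like lower bound).** There is an absolute constant $c>0$ such that for every $n$ and every linear polynomial $f$ over $\mathbb{Q}$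 that depends on $n$ variables and satisfies $0\notin\mathrm{im}_2(f)$, every tree-like $\mathrm{Res}(\mathrm{lin}_{\mathbb{Q}})$ refutation of $f=0$ has size at least $2^{c\sqrt{n}}$. (The constant $c$ does not depend on $f$; in particular the bound holds also when the coefficients of $f$ are small.) -/

import Mathlib

namespace ResLin

/-- A linear polynomial `∑ aᵢ xᵢ + b` over `R` in the variables `x₀, x₁, x₂, …`, given by its
finitely supported family of coefficients `(aᵢ)` and its constant term `b`. -/
abbrev LinPoly (R : Type) [Ring R] : Type := (ℕ →₀ R) × R

namespace LinPoly

variable {R : Type} [Ring R]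

/-- The value of a linear polynomial at an assignment of ring elements to the variables. -/
def eval (f : LinPoly R) (x : ℕ → R) : R :=
  (f.1.sum fun i a => a * x i) + f.2

/-- `im₂(f)`: the set of values of `f` under 0-1 assignments. -/
def im2 (f : LinPoly R) : Set R :=
  {r | ∃ x : ℕ → R, (∀ i, x i = 0 ∨ x i = 1) ∧ f.eval x = r}

/-- The finite set of variables on which `f` depends. -/
def vars (f : LinPoly R) : Finset ℕ := f.1.support

/-- The linear polynomial `xᵢ`. -/
noncomputable def var (i : ℕ) : LinPoly R := (Finsupp.single i 1, 0)

/-- The constant linear polynomial `a`. -/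
def const (a : R) : LinPoly R := (0, a)

end LinPoly

/-- A linear clause `f₁ = 0 ∨ … ∨ fₖ = 0`, as the finite set `{f₁, …, fₖ}` of its disjuncts
(so duplicate disjuncts are contracted). -/
abbrev Clause (R : Type) [Ring R] : Type := Finset (LinPoly R)

section Rules

variable {R : Type} [Ring R] [DecidableEq R]

/-- The boolean clause `xᵢ = 0 ∨ xᵢ = 1`. -/
noncomputable def boolClause (R : Type) [Ring R] [DecidableEq R] (i : ℕ) : Clause R :=
  {LinPoly.var i, LinPoly.var i - LinPoly.const 1}

/-- Resolution: from `C ∨ f = 0` and `D ∨ g = 0` derive `C ∨ D ∨ α f + β g = 0`. -/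
def IsResolution (P Q E : Clause R) : Prop :=
  ∃ (C D : Clause R) (f g : LinPoly R) (α β : R),
    P = insert f C ∧ Q = insert g D ∧ E = insert (α • f + β • g) (C ∪ D)

/-- Simplification: from `C ∨ a = 0` with `a ≠ 0` a constant, derive `C`. -/
def IsSimplification (P E : Clause R) : Prop :=
  ∃ a : R, a ≠ 0 ∧ P = insert (LinPoly.const a) E

/-- Weakening: from `C` derive `C ∨ f = 0`. -/
def IsWeakening (P E : Clause R) : Prop :=
  ∃ f : LinPoly R, E = insert f P

end Rules

/-- The justification of a line in a derivation with `s` lines; `j`, `k` are the positions of the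
premises. -/
inductive Step (s : ℕ) : Type
  | hypothesis : Step s
  | boolean (i : ℕ) : Step s
  | resolution (j k : Fin s) : Step s
  | simplification (j : Fin s) : Step s
  | weakening (j : Fin s) : Step s

/-- The positions of the lines that a step uses as premises, with multiplicity. -/
def Step.premises {s : ℕ} : Step s → List (Fin s)
  | .hypothesis => []
  | .boolean _ => []
  | .resolution j k => [j, k]
  | .simplification j => [j]
  | .weakening j => [j]

/-- Line `t` of the sequence `L` is correctly justified by the given step: it belongs to `φ`, is a
boolean clause, or follows from earlier lines by one of the rules. -/
def Step.Justifies {R : Type} [Ring R] [DecidableEq R] {s : ℕ} (φ : Set (Clause R))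
    (L : Fin s → Clause R) (t : Fin s) : Step s → Prop
  | .hypothesis => L t ∈ φ
  | .boolean i => L t = boolClause R i
  | .resolution j k => j < t ∧ k < t ∧ IsResolution (L j) (L k) (L t)
  | .simplification j => j < t ∧ IsSimplification (L j) (L t)
  | .weakening j => j < t ∧ IsWeakening (L j) (L t)

/-- A Res(lin_R) derivation of the linear clause `D` from the set `φ` of linear clauses:
a nonempty sequence of linear clauses ending in `D`, with a justification for every line. -/
structure Derivation {R : Type} [Ring R] [DecidableEq R] (φ : Set (Clause R)) (D : Clause R) where
  last : ℕ
  line : Fin (last + 1) → Clause R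
  step : Fin (last + 1) → Step (last + 1)
  justified : ∀ t, (step t).Justifies φ line t
  line_last : line (Fin.last last) = D

/-- A Res(lin_R) refutation of `φ`: a derivation of the empty clause from `φ`. -/
abbrev Refutation {R : Type} [Ring R] [DecidableEq R] (φ : Set (Clause R)) : Type :=
  Derivation φ (∅ : Clause R)

/-- A derivation is tree-like if every line is used at most once as a premise of a rule. -/
def Derivation.TreeLike {R : Type} [Ring R] [DecidableEq R] {φ : Set (Clause R)} {D : Clause R}
    (π : Derivation φ D) : Prop :=
  ∀ j, ∑ t, (π.step t).premises.count j ≤ 1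

/-- The length of the binary representation of a natural number (`0` has length `1`). -/
def natSize (m : ℕ) : ℕ := max 1 m.size

/-- The size of a rational coefficient: the binary length of an integer, and for a proper fraction
in lowest terms the binary lengths of its numerator and denominator together. -/
def coeffSize (q : ℚ) : ℕ :=
  natSize q.num.natAbs + if q.den = 1 then 0 else natSize q.den

/-- The total size of the coefficients of `f`, including its constant term. -/
def LinPoly.coeffsSize (f : LinPoly ℚ) : ℕ :=
  (∑ i ∈ f.vars, coeffSize (f.1 i)) + coeffSize f.2

/-- The size of a clause: the number of occurrences of variables in it plus the total size of the
coefficients occurring in it. -/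
def Clause.size (C : Clause ℚ) : ℕ :=
  ∑ f ∈ C, (f.vars.card + f.coeffsSize)

/-- The size of a derivation: the total size of its clauses. -/
def Derivation.size {φ : Set (Clause ℚ)} {D : Clause ℚ} (π : Derivation φ D) : ℕ :=
  ∑ t, Clause.size (π.line t)

end ResLin

namespace ResLin

/-! An adversary walks up the proof tree from the empty clause, always at a clause it can falsify
while pretending that `F = 0`. It keeps a set `A` of disequalities true at a point `y`, and a small
set `W` of variables fixed as in `y`. At a resolution step `αf + βg ≠ 0` is known. If `f ≠ 0` and `g
≠ 0` are both consistent with the state modulo `F`, either premise can be falsified at the cost of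
one more disequality: a binary choice. Otherwise one of them is excluded, and fixing few variables
forces the walk to the other premise for free. No leaf is falsifiable within `K` choices, so the
tree has at least `2 ^ K` leaves.

A free move is cheap by a covering argument in the style of Alon and Füredi: hyperplanes covering
all vertices of an `m`-cube but one number at least `m`. Hence a minimal set of `k` disequalities
forcing `f = 0` involves, together with `f`, at most `4 k ^ 2` free variables
(`exists_entailing_subset`). Fixing these makes the `k` disequalities redundant, so `W` stays below
`4 K ^ 2`. Pretending `F = 0` is harmless as long as `F` has more than about `8 K ^ 2` variables
(`IsState.eval_ne_zero_of_known`), whence `K` of order `√n`. -/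

/-- An alternating sum over a cube of a product of fewer affine functions than the dimension of the
cube vanishes. -/
theorem sum_powerset_neg_one_pow_mul_prod_eq_zero {ι κ : Type*} [DecidableEq ι] [DecidableEq κ]
    (a : κ → ι → ℚ) (J : Finset κ) :
    ∀ (I : Finset ι) (c : κ → ℚ), J.card < I.card →
      ∑ S ∈ I.powerset, (-1 : ℚ) ^ S.card * ∏ j ∈ J, (c j + ∑ i ∈ S, a j i) = 0 := by
  induction J using Finset.induction_on with
  | empty =>
    intro I c h
    have hne : I.Nonempty := Finset.card_pos.mp (by simpa using h)
    have := Finset.sum_powerset_neg_one_pow_card_of_nonempty hne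
    have h2 : ((∑ m ∈ I.powerset, (-1 : ℤ) ^ m.card : ℤ) : ℚ) = 0 := by rw [this]; simp
    push_cast at h2
    simpa using h2
  | insert j J hj ih =>
    intro I c h
    rw [Finset.card_insert_of_notMem hj] at h
    -- Expanding the factor of `j` leaves, for each `i`, a sum over the sets containing `i`.
    -- Removing `i` turns it into a sum over a cube of one dimension less, with shifted constants
    -- and one factor fewer.
    have key : ∀ i ∈ I, ∑ S ∈ I.powerset, (if i ∈ S then
        (-1 : ℚ) ^ S.card * ∏ j ∈ J, (c j + ∑ i ∈ S, a j i) else 0) = 0 := by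
      intro i hi
      have h1 := ih (I.erase i) (fun j => c j + a j i)
        (by rw [Finset.card_erase_of_mem hi]; omega)
      rw [← Finset.insert_erase hi, Finset.sum_powerset_insert (Finset.notMem_erase i I)]
      rw [Finset.sum_eq_zero, zero_add, ← neg_eq_zero, ← h1, ← Finset.sum_neg_distrib]
      · refine Finset.sum_congr rfl fun S hS => ?_
        have hiS : i ∉ S := fun h => Finset.notMem_erase i I (Finset.mem_powerset.mp hS h)
        rw [if_pos (Finset.mem_insert_self i S), Finset.card_insert_of_notMem hiS, pow_succ]
        have : ∀ j, c j + ∑ i ∈ insert i S, a j i = c j + a j i + ∑ i ∈ S, a j i := fun j => by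
          rw [Finset.sum_insert hiS, add_assoc]
        simp only [this]
        ring
      · intro S hS
        have hiS : i ∉ S := fun h => Finset.notMem_erase i I (Finset.mem_powerset.mp hS h)
        rw [if_neg hiS]
    have expand : ∀ S ∈ I.powerset,
        (-1 : ℚ) ^ S.card * ∏ j ∈ insert j J, (c j + ∑ i ∈ S, a j i) =
        c j * ((-1 : ℚ) ^ S.card * ∏ j ∈ J, (c j + ∑ i ∈ S, a j i)) +
        ∑ i ∈ I, a j i * (if i ∈ S then
          (-1 : ℚ) ^ S.card * ∏ j ∈ J, (c j + ∑ i ∈ S, a j i) else 0) := by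
      intro S hS
      rw [Finset.prod_insert hj]
      have : ∑ i ∈ I, a j i * (if i ∈ S then
          (-1 : ℚ) ^ S.card * ∏ j ∈ J, (c j + ∑ i ∈ S, a j i) else 0) =
          (∑ i ∈ S, a j i) * ((-1 : ℚ) ^ S.card * ∏ j ∈ J, (c j + ∑ i ∈ S, a j i)) := by
        rw [Finset.sum_mul]
        simp only [mul_ite, mul_zero]
        rw [← Finset.sum_filter, Finset.filter_mem_eq_inter,
          Finset.inter_eq_right.mpr (Finset.mem_powerset.mp hS)]
      rw [this]
      ring
    rw [Finset.sum_congr rfl expand, Finset.sum_add_distrib, ← Finset.mul_sum,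
      ih I c (by omega), mul_zero, zero_add, Finset.sum_comm]
    refine Finset.sum_eq_zero fun i hi => ?_
    rw [← Finset.mul_sum, key i hi, mul_zero]

/-! ### Values and variables of linear polynomials -/

namespace LinPoly

theorem eval_eq_sum (f : LinPoly ℚ) {T : Finset ℕ} (hT : f.vars ⊆ T) (x : ℕ → ℚ) :
    f.eval x = ∑ i ∈ T, f.1 i * x i + f.2 := by
  unfold eval
  rw [Finsupp.sum_of_support_subset _ hT _ (by simp)]

theorem eval_add (f g : LinPoly ℚ) (x : ℕ → ℚ) : (f + g).eval x = f.eval x + g.eval x := by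
  unfold eval
  rw [Prod.fst_add, Finsupp.sum_add_index' (by simp) (by intros; ring), Prod.snd_add]
  ring

theorem eval_smul (a : ℚ) (f : LinPoly ℚ) (x : ℕ → ℚ) : (a • f).eval x = a * f.eval x := by
  unfold eval
  rw [Prod.smul_fst, Finsupp.sum_smul_index' (by simp), Prod.smul_snd, mul_add, Finsupp.mul_sum]
  simp [mul_assoc]

theorem eval_sub (f g : LinPoly ℚ) (x : ℕ → ℚ) : (f - g).eval x = f.eval x - g.eval x := by
  have := eval_add (f - g) g x
  rw [sub_add_cancel] at this
  linarith

@[simp] theorem eval_const (a : ℚ) (x : ℕ → ℚ) : (const a).eval x = a := by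
  simp [eval, const]

@[simp] theorem eval_var (i : ℕ) (x : ℕ → ℚ) : (var i : LinPoly ℚ).eval x = x i := by
  simp [eval, var]

@[simp] theorem vars_const (a : ℚ) : (const a).vars = ∅ := by
  simp [vars, const]

theorem vars_add_subset (f g : LinPoly ℚ) : (f + g).vars ⊆ f.vars ∪ g.vars :=
  Finsupp.support_add

theorem vars_sub_subset (f g : LinPoly ℚ) : (f - g).vars ⊆ f.vars ∪ g.vars :=
  Finsupp.support_sub

theorem vars_smul_subset (a : ℚ) (f : LinPoly ℚ) : (a • f).vars ⊆ f.vars :=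
  Finsupp.support_smul

theorem vars_smul (a : ℚ) (ha : a ≠ 0) (f : LinPoly ℚ) : (a • f).vars = f.vars :=
  Finsupp.support_smul_eq ha

@[simp] theorem vars_var (i : ℕ) : (var i : LinPoly ℚ).vars = {i} := by
  simp [vars, var]

theorem eval_congr (f : LinPoly ℚ) {x y : ℕ → ℚ} (h : ∀ i ∈ f.vars, x i = y i) :
    f.eval x = f.eval y := by
  rw [eval_eq_sum f subset_rfl, eval_eq_sum f subset_rfl]
  congr 1
  exact Finset.sum_congr rfl fun i hi => by rw [h i hi]

/-- The point obtained from `x` by flipping the coordinates in `S`. -/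
def flip (x : ℕ → ℚ) (S : Finset ℕ) : ℕ → ℚ := fun i => if i ∈ S then 1 - x i else x i

theorem eval_flip (f : LinPoly ℚ) (x : ℕ → ℚ) (S : Finset ℕ) :
    f.eval (flip x S) = f.eval x + ∑ i ∈ S, f.1 i * (1 - 2 * x i) := by
  have h : ∑ i ∈ S, f.1 i * (1 - 2 * x i) =
      ∑ i ∈ f.vars ∪ S, if i ∈ S then f.1 i * (1 - 2 * x i) else 0 := by
    rw [← Finset.sum_filter, Finset.filter_mem_eq_inter,
      Finset.inter_eq_right.mpr Finset.subset_union_right]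
  rw [eval_eq_sum f (Finset.subset_union_left (s₂ := S)),
    eval_eq_sum f (Finset.subset_union_left (s₂ := S)), h, add_right_comm,
    ← Finset.sum_add_distrib]
  congr 1
  refine Finset.sum_congr rfl fun i _ => ?_
  unfold flip
  split_ifs <;> ring

end LinPoly

open LinPoly

/-! ### Subcubes and the covering bound -/

/-- `x` is a 0-1 assignment that agrees with `y` on `W`. -/
def InSubcube (W : Finset ℕ) (y x : ℕ → ℚ) : Prop :=
  (∀ i, x i = 0 ∨ x i = 1) ∧ ∀ i ∈ W, x i = y i

theorem InSubcube.flip {W : Finset ℕ} {y x : ℕ → ℚ} (h : InSubcube W y x) {S : Finset ℕ}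
    (hS : Disjoint S W) : InSubcube W y (flip x S) := by
  refine ⟨fun i => ?_, fun i hi => ?_⟩
  · unfold LinPoly.flip
    rcases h.1 i with h | h <;> split_ifs <;> simp [h]
  · unfold LinPoly.flip
    rw [if_neg (fun hiS => Finset.disjoint_left.mp hS hiS hi), h.2 i hi]

theorem one_sub_two_mul_ne_zero {t : ℚ} (h : t = 0 ∨ t = 1) : 1 - 2 * t ≠ 0 := by
  rcases h with h | h <;> norm_num [h]

theorem vars_subset_of_eval_eq_zero {W : Finset ℕ} {y : ℕ → ℚ} (hy : ∀ i, y i = 0 ∨ y i = 1)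
    {p : LinPoly ℚ} (hp : ∀ x, InSubcube W y x → p.eval x = 0) : p.vars ⊆ W := by
  intro i hi
  by_contra hiW
  have h0 : InSubcube W y y := ⟨hy, fun _ _ => rfl⟩
  have h1 := hp _ (h0.flip (S := {i}) (by simpa using hiW))
  rw [eval_flip, hp _ h0, zero_add, Finset.sum_singleton] at h1
  exact mul_ne_zero (Finsupp.mem_support_iff.mp hi) (one_sub_two_mul_ne_zero (hy i)) h1

/-- If the hyperplane `h = 0` covers the part of a subcube missed by the hyperplanes in `J`, and this
part is nonempty, then `h` has at most `2 |J|` free variables. -/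
theorem card_vars_sdiff_le {W : Finset ℕ} {z : ℕ → ℚ} (hz : ∀ i, z i = 0 ∨ z i = 1)
    {h : LinPoly ℚ} {J : Finset (LinPoly ℚ)} (hJ : ∀ g ∈ J, g.eval z ≠ 0) (h0 : h.eval z = 0)
    (hcov : ∀ x, InSubcube W z x → h.eval x ≠ 0 → ∃ g ∈ J, g.eval x = 0) :
    (h.vars \ W).card ≤ 2 * J.card := by
  set d : ℕ → ℚ := fun i => h.1 i * (1 - 2 * z i) with hd
  have hz0 : InSubcube W z z := ⟨hz, fun _ _ => rfl⟩
  -- On the cube obtained from `z` by flipping subsets of `I`, `h` vanishes only at `z`, so `J`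
  -- covers every vertex but `z`. The product over `J` then has a nonzero alternating sum, which
  -- needs at least `|I|` factors.
  have aux : ∀ I ⊆ h.vars \ W, (∀ S ⊆ I, S.Nonempty → ∑ i ∈ S, d i ≠ 0) → I.card ≤ J.card := by
    intro I hI hne
    by_contra hlt
    have hs := sum_powerset_neg_one_pow_mul_prod_eq_zero
      (fun (g : LinPoly ℚ) i => g.1 i * (1 - 2 * z i)) J I (fun g => g.eval z) (by omega)
    simp only [← eval_flip] at hs
    rw [Finset.sum_eq_single ∅] at hs
    · rw [Finset.card_empty, pow_zero, one_mul, Finset.prod_eq_zero_iff] at hs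
      obtain ⟨g, hg, hg0⟩ := hs
      rw [eval_flip, Finset.sum_empty, add_zero] at hg0
      exact hJ g hg hg0
    · intro S hS hS0
      rw [Finset.mem_powerset] at hS
      obtain ⟨g, hg, hg0⟩ := hcov (LinPoly.flip z S)
        (hz0.flip (Finset.disjoint_of_subset_left (hS.trans hI) Finset.sdiff_disjoint))
        (by rw [eval_flip, h0, zero_add]
            exact hne S hS (Finset.nonempty_iff_ne_empty.mpr hS0))
      rw [Finset.prod_eq_zero hg hg0, mul_zero]
    · intro h
      exact absurd (Finset.empty_mem_powerset I) h
  -- Changes of equal sign cannot cancel; treating each sign separately costs the factor 2.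
  have hpos := aux ((h.vars \ W).filter fun i => 0 < d i) (Finset.filter_subset _ _)
    fun S hS hSne => (Finset.sum_pos (fun i hi => (Finset.mem_filter.mp (hS hi)).2) hSne).ne'
  have hneg := aux ((h.vars \ W).filter fun i => ¬ 0 < d i) (Finset.filter_subset _ _)
    fun S hS hSne => (Finset.sum_neg (fun i hi => by
      have h1 := Finset.mem_filter.mp (hS hi)
      refine lt_of_le_of_ne (not_lt.mp h1.2) (mul_ne_zero ?_ (one_sub_two_mul_ne_zero (hz i)))
      exact Finsupp.mem_support_iff.mp (Finset.mem_sdiff.mp h1.1).1) hSne).ne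
  have := Finset.card_filter_add_card_filter_not (s := h.vars \ W) (fun i => 0 < d i)
  omega

/-- If the disequalities in `A` hold at `y` and imply `f = 0` on a subcube, then some `k` of them
imply it, and these together with `f` have at most `4 k ^ 2` free variables. -/
theorem exists_entailing_subset {W : Finset ℕ} {y : ℕ → ℚ} (hy : ∀ i, y i = 0 ∨ y i = 1)
    {A : Finset (LinPoly ℚ)} (hA : ∀ g ∈ A, g.eval y ≠ 0) {f : LinPoly ℚ}
    (hf : ∀ x, InSubcube W y x → (∀ g ∈ A, g.eval x ≠ 0) → f.eval x = 0) :
    ∃ B ⊆ A, (∀ x, InSubcube W y x → (∀ g ∈ B, g.eval x ≠ 0) → f.eval x = 0) ∧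
      (((insert f B).biUnion fun g => g.vars \ W).card ≤ 4 * B.card ^ 2) := by
  classical
  obtain ⟨B, hBA, hB⟩ := exists_minimal_le_of_wellFoundedLT
    (fun B : Finset (LinPoly ℚ) =>
      ∀ x, InSubcube W y x → (∀ g ∈ B, g.eval x ≠ 0) → f.eval x = 0) A hf
  refine ⟨B, hBA, hB.prop, ?_⟩
  have hy0 : InSubcube W y y := ⟨hy, fun _ _ => rfl⟩
  have bound : ∀ g ∈ insert f B, (g.vars \ W).card ≤ 2 * B.card := by
    intro g hg
    rcases Finset.mem_insert.mp hg with rfl | hg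
    · refine card_vars_sdiff_le hy (fun g hg => hA g (hBA hg))
        (hB.prop y hy0 fun g hg => hA g (hBA hg)) fun x hx hne => ?_
      by_contra! hcon
      exact hne (hB.prop x hx hcon)
    -- By minimality, dropping `g` breaks the implication at some `z`, where `g` must vanish. The
    -- covering bound applies at `z` with `f` taking the place of `g` among the hyperplanes.
    · have hnot : ¬ ∀ x, InSubcube W y x → (∀ p ∈ B.erase g, p.eval x ≠ 0) → f.eval x = 0 :=
        fun h => Finset.notMem_erase g B (hB.le_of_le h (Finset.erase_subset g B) hg)
      push Not at hnot
      obtain ⟨z, hz, hzB, hzf⟩ := hnot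
      have hg0 : g.eval z = 0 := by
        by_contra hne
        refine hzf (hB.prop z hz fun p hp => ?_)
        by_cases hpg : p = g
        · rwa [hpg]
        · exact hzB p (Finset.mem_erase.mpr ⟨hpg, hp⟩)
      refine (card_vars_sdiff_le hz.1 (J := insert f (B.erase g)) ?_ hg0 ?_).trans ?_
      · intro p hp
        rcases Finset.mem_insert.mp hp with rfl | hp
        exacts [hzf, hzB p hp]
      · intro x hx hne
        by_contra! hcon
        refine hcon f (Finset.mem_insert_self _ _) (hB.prop x
          ⟨hx.1, fun i hi => (hx.2 i hi).trans (hz.2 i hi)⟩ fun p hp => ?_)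
        by_cases hpg : p = g
        · rwa [hpg]
        · exact hcon p (Finset.mem_insert_of_mem (Finset.mem_erase.mpr ⟨hpg, hp⟩))
      · have h1 := Finset.card_insert_le f (B.erase g)
        rw [Finset.card_erase_of_mem hg] at h1
        have := Finset.card_pos.mpr ⟨g, hg⟩
        omega
  have h1 := Finset.card_biUnion_le_card_mul _ _ _ bound
  have h2 := Finset.card_insert_le f B
  -- The bound `2k(k + 1)` is at most `4k ^ 2` only for `k ≥ 1`; for `k = 0` it is already zero.
  rcases Nat.eq_zero_or_pos B.card with h | h
  · rw [h] at h1 ⊢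
    simpa using h1
  · nlinarith

/-! ### States of the adversary -/

/-- The disequality `h ≠ 0` follows, on a subcube and modulo multiples of `F`, from one of the
disequalities in `A` or from `1 ≠ 0`. -/
def Known (F : LinPoly ℚ) (A : Finset (LinPoly ℚ)) (W : Finset ℕ) (y : ℕ → ℚ)
    (h : LinPoly ℚ) : Prop :=
  ∃ p ∈ insert (const 1) A, ∃ c : ℚ, c ≠ 0 ∧ ∃ a : ℚ,
    ∀ x, InSubcube W y x → h.eval x = c * p.eval x + a * F.eval x

/-- A state of the adversary that has made at most `k` binary choices: `y` satisfies the
disequalities in `A`, the variables in `W` are fixed to their values at `y`, and each member of `A`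
has few variables if it has few variables modulo `F`. -/
structure IsState (F : LinPoly ℚ) (M k : ℕ) (A : Finset (LinPoly ℚ)) (W : Finset ℕ)
    (y : ℕ → ℚ) (d : ℕ) : Prop where
  bool : ∀ i, y i = 0 ∨ y i = 1
  eval_ne_zero : ∀ p ∈ A, p.eval y ≠ 0
  card_add_le : A.card + d ≤ k
  card_fixed_le : W.card ≤ 4 * d ^ 2
  canonical : ∀ p ∈ A, ∀ a : ℚ, (p - a • F).vars.card ≤ M → p.vars.card ≤ M

/-- The adversary can falsify the clause `D` after at most `k` binary choices. -/
def Falsifiable (F : LinPoly ℚ) (M k : ℕ) (D : Clause ℚ) : Prop :=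
  ∃ A W y d, IsState F M k A W y d ∧ ∀ h ∈ D, Known F A W y h

variable {F : LinPoly ℚ} {M k K : ℕ} {A : Finset (LinPoly ℚ)} {W : Finset ℕ} {y : ℕ → ℚ} {d : ℕ}

theorem IsState.inSubcube (hs : IsState F M k A W y d) : InSubcube W y y :=
  ⟨hs.bool, fun _ _ => rfl⟩

/-- Take a multiple of `F` whose subtraction leaves at most `M` variables; if there is none, `a = 0`
works vacuously. -/
theorem exists_canonical (F : LinPoly ℚ) (M : ℕ) (f : LinPoly ℚ) :
    ∃ a : ℚ, ∀ b : ℚ, ((f - a • F) - b • F).vars.card ≤ M → (f - a • F).vars.card ≤ M := by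
  by_cases h : ∃ a : ℚ, (f - a • F).vars.card ≤ M
  · obtain ⟨a, ha⟩ := h
    exact ⟨a, fun _ _ => ha⟩
  · refine ⟨0, fun b hb => (h ⟨b, ?_⟩).elim⟩
    simpa using hb

/-- A known disequality in at most one variable holds at the current point. -/
theorem IsState.eval_ne_zero_of_known (hs : IsState F (4 * K ^ 2 + 1) k A W y d) (hk : k ≤ K)
    (hF : 8 * K ^ 2 + 3 ≤ F.vars.card) {h : LinPoly ℚ} (hh : h.vars.card ≤ 1)
    (hknown : Known F A W y h) : h.eval y ≠ 0 := by
  obtain ⟨p, hp, c, hc, a, hx⟩ := hknown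
  have hW : W.card ≤ 4 * K ^ 2 := by
    have h1 := hs.card_fixed_le
    have h2 : d ≤ K := by have := hs.card_add_le; omega
    have := Nat.pow_le_pow_left h2 2
    omega
  have hpy : p.eval y ≠ 0 := by
    rcases Finset.mem_insert.mp hp with rfl | hp
    · simp
    · exact hs.eval_ne_zero p hp
  have hcanon : ∀ b : ℚ, (p - b • F).vars.card ≤ 4 * K ^ 2 + 1 →
      p.vars.card ≤ 4 * K ^ 2 + 1 := by
    rcases Finset.mem_insert.mp hp with rfl | hp
    · simp
    · exact hs.canonical p hp
  have hsub : (c • p + a • F - h).vars ⊆ W := by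
    refine vars_subset_of_eval_eq_zero hs.bool fun x hxW => ?_
    rw [eval_sub, eval_add, eval_smul, eval_smul, hx x hxW, sub_self]
  -- If `a ≠ 0`, then `p` has few variables modulo `F`, hence few outright by canonicity. Then `a •
  -- F` has at most `2(4K ^ 2 + 1)` variables, too few for `F`.
  have ha : a = 0 := by
    by_contra ha
    have h1 : (p - (-(c⁻¹ * a)) • F).vars.card ≤ 4 * K ^ 2 + 1 := by
      have e : p - (-(c⁻¹ * a)) • F = c⁻¹ • ((c • p + a • F - h) + h) := by
        rw [sub_add_cancel, smul_add, smul_smul, smul_smul, inv_mul_cancel₀ hc, one_smul,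
          neg_smul, sub_neg_eq_add]
      rw [e]
      have h2 := Finset.card_le_card ((vars_smul_subset c⁻¹ _).trans
        (vars_add_subset (c • p + a • F - h) h))
      have h3 := Finset.card_union_le (c • p + a • F - h).vars h.vars
      have h4 := Finset.card_le_card hsub
      omega
    have h2 := hcanon _ h1
    have e : a • F = ((c • p + a • F - h) + h) - c • p := by abel
    have h3 : F.vars.card ≤ (((c • p + a • F - h) + h) - c • p).vars.card := by
      rw [← e, vars_smul a ha]
    have h4 := Finset.card_le_card (vars_sub_subset ((c • p + a • F - h) + h) (c • p))
    have h5 := Finset.card_union_le ((c • p + a • F - h) + h).vars (c • p).vars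
    have h6 := Finset.card_le_card (vars_add_subset (c • p + a • F - h) h)
    have h7 := Finset.card_union_le (c • p + a • F - h).vars h.vars
    have h8 := Finset.card_le_card hsub
    have h9 := Finset.card_le_card (vars_smul_subset c p)
    omega
  rw [hx y hs.inSubcube, ha, zero_mul, add_zero]
  exact mul_ne_zero hc hpy

/-! ### Moves of the adversary -/

/-- A free move: if the state excludes `f ≠ 0`, then fixing some variables makes `f` vanish. -/
theorem IsState.exists_fix (hs : IsState F M k A W y d) {f : LinPoly ℚ}
    (hf : ∀ x, InSubcube W y x → (∀ g ∈ A, g.eval x ≠ 0) → f.eval x = 0) :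
    ∃ A' W' d', IsState F M k A' W' y d' ∧ (∀ x, InSubcube W' y x → f.eval x = 0) ∧
      ∀ h, Known F A W y h → Known F A' W' y h := by
  classical
  obtain ⟨B, hBA, hB, hcard⟩ := exists_entailing_subset hs.bool hs.eval_ne_zero hf
  set U := (insert f B).biUnion fun g => g.vars \ W with hU
  have hsub : ∀ x, InSubcube (W ∪ U) y x → InSubcube W y x := fun x hx =>
    ⟨hx.1, fun i hi => hx.2 i (Finset.mem_union_left _ hi)⟩
  have hvars : ∀ g ∈ B, ∀ x, InSubcube (W ∪ U) y x → g.eval x = g.eval y := by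
    refine fun g hg x hx => eval_congr g fun i hi => hx.2 i ?_
    by_cases hiW : i ∈ W
    · exact Finset.mem_union_left _ hiW
    · exact Finset.mem_union_right _ (Finset.mem_biUnion.mpr
        ⟨g, Finset.mem_insert_of_mem hg, Finset.mem_sdiff.mpr ⟨hi, hiW⟩⟩)
  -- Members of `B` move from `A` to the count `d`, so the budget is unchanged, and `4d ^ 2 + 4|B| ^
  -- 2 ≤ 4(d + |B|) ^ 2` pays for the new fixed variables.
  refine ⟨A \ B, W ∪ U, d + B.card, ⟨hs.bool, ?_, ?_, ?_, ?_⟩, ?_, ?_⟩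
  · exact fun p hp => hs.eval_ne_zero p (Finset.mem_sdiff.mp hp).1
  · have h1 := Finset.card_sdiff_add_card_eq_card hBA
    have := hs.card_add_le
    omega
  · have h1 := Finset.card_union_le W U
    have h2 := hs.card_fixed_le
    have h3 : 4 * (d + B.card) ^ 2 = 4 * d ^ 2 + 4 * B.card ^ 2 + 8 * (d * B.card) := by ring
    rw [h3]
    omega
  · exact fun p hp => hs.canonical p (Finset.mem_sdiff.mp hp).1
  · exact fun x hx => hB x (hsub x hx) fun g hg => by
      rw [hvars g hg x hx]
      exact hs.eval_ne_zero g (hBA hg)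
  · rintro h ⟨p, hp, c, hc, a, hx⟩
    by_cases hpB : p ∈ B
    -- All variables of `p` are now fixed, so `p` is a nonzero constant and `1 ≠ 0` replaces it.
    · refine ⟨const 1, Finset.mem_insert_self _ _, c * p.eval y,
        mul_ne_zero hc (hs.eval_ne_zero p (hBA hpB)), a, fun x hxU => ?_⟩
      rw [hx x (hsub x hxU), hvars p hpB x hxU, eval_const, mul_one]
    · refine ⟨p, ?_, c, hc, a, fun x hxU => hx x (hsub x hxU)⟩
      rcases Finset.mem_insert.mp hp with rfl | hp
      · exact Finset.mem_insert_self _ _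
      · exact Finset.mem_insert_of_mem (Finset.mem_sdiff.mpr ⟨hp, hpB⟩)

/-- If the state excludes `f - a F ≠ 0`, then it can be changed, without a binary choice, so that
`g ≠ 0` becomes known. -/
theorem IsState.falsifiable_of_excluded (hs : IsState F (4 * K ^ 2 + 1) k A W y d) (hk : k ≤ K)
    (hF : 8 * K ^ 2 + 3 ≤ F.vars.card) {f g : LinPoly ℚ} {α β a : ℚ} {D : Clause ℚ}
    (hD : ∀ h ∈ D, Known F A W y h) (hfg : Known F A W y (α • f + β • g))
    (hf : ∀ x, InSubcube W y x → (∀ g ∈ A, g.eval x ≠ 0) → (f - a • F).eval x = 0) :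
    Falsifiable F (4 * K ^ 2 + 1) k (insert g D) := by
  obtain ⟨A', W', d', hs', hzero, hmono⟩ := hs.exists_fix hf
  refine ⟨A', W', y, d', hs', fun h hh => ?_⟩
  rcases Finset.mem_insert.mp hh with rfl | hh
  · obtain ⟨p, hp, c, hc, b, hx⟩ := hmono _ hfg
    have key : ∀ x, InSubcube W' y x →
        β * h.eval x = c * p.eval x + (b - α * a) * F.eval x := by
      intro x hxW
      have h1 := hx x hxW
      have h2 := hzero x hxW
      rw [eval_add, eval_smul, eval_smul] at h1
      rw [eval_sub, eval_smul] at h2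
      linear_combination h1 - α * h2
    -- With `β = 0` the state would know `0 ≠ 0` modulo `F`, which is impossible.
    by_cases hβ : β = 0
    · refine (hs'.eval_ne_zero_of_known hk hF (h := const 0) (by simp)
        ⟨p, hp, c, hc, b - α * a, fun x hxW => ?_⟩ (by simp)).elim
      rw [← key x hxW, hβ, zero_mul, eval_const]
    · refine ⟨p, hp, β⁻¹ * c, mul_ne_zero (inv_ne_zero hβ) hc, β⁻¹ * (b - α * a),
        fun x hxW => ?_⟩
      rw [mul_assoc, mul_assoc, ← mul_add, ← key x hxW, inv_mul_cancel_left₀ hβ]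
  · exact hmono h (hD h hh)

/-- A binary choice: a disequality that is consistent with the state can be added to it. -/
theorem IsState.falsifiable_insert (hs : IsState F M k A W y d) {f : LinPoly ℚ} {a : ℚ}
    (ha : ∀ b : ℚ, ((f - a • F) - b • F).vars.card ≤ M → (f - a • F).vars.card ≤ M)
    {D : Clause ℚ} (hD : ∀ h ∈ D, Known F A W y h) {x : ℕ → ℚ} (hx : InSubcube W y x)
    (hxA : ∀ g ∈ A, g.eval x ≠ 0) (hxf : (f - a • F).eval x ≠ 0) :
    Falsifiable F M (k + 1) (insert f D) := by
  classical
  have hsub : ∀ z, InSubcube W x z → InSubcube W y z := fun z hz =>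
    ⟨hz.1, fun i hi => (hz.2 i hi).trans (hx.2 i hi)⟩
  -- The current point moves to `x`, which agrees with `y` on `W`.
  refine ⟨insert (f - a • F) A, W, x, d, ⟨hx.1, ?_, ?_, hs.card_fixed_le, ?_⟩, ?_⟩
  · intro p hp
    rcases Finset.mem_insert.mp hp with rfl | hp
    exacts [hxf, hxA p hp]
  · have h1 := Finset.card_insert_le (f - a • F) A
    have := hs.card_add_le
    omega
  · intro p hp
    rcases Finset.mem_insert.mp hp with rfl | hp
    exacts [ha, hs.canonical p hp]
  · intro h hh
    rcases Finset.mem_insert.mp hh with rfl | hh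
    · refine ⟨h - a • F, by simp, 1, one_ne_zero, a, fun z _ => ?_⟩
      rw [eval_sub, eval_smul]
      ring
    · obtain ⟨p, hp, c, hc, b, hz⟩ := hD h hh
      refine ⟨p, ?_, c, hc, b, fun z hzW => hz z (hsub z hzW)⟩
      rcases Finset.mem_insert.mp hp with rfl | hp
      · exact Finset.mem_insert_self _ _
      · exact Finset.mem_insert_of_mem (Finset.mem_insert_of_mem hp)

theorem Falsifiable.of_resolution {P Q E : Clause ℚ} (hE : Falsifiable F (4 * K ^ 2 + 1) k E)
    (hk : k ≤ K) (hF : 8 * K ^ 2 + 3 ≤ F.vars.card) (hr : IsResolution P Q E) :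
    Falsifiable F (4 * K ^ 2 + 1) k P ∨ Falsifiable F (4 * K ^ 2 + 1) k Q ∨
      (Falsifiable F (4 * K ^ 2 + 1) (k + 1) P ∧ Falsifiable F (4 * K ^ 2 + 1) (k + 1) Q) := by
  obtain ⟨C, D, f, g, α, β, rfl, rfl, rfl⟩ := hr
  obtain ⟨A, W, y, d, hs, hknown⟩ := hE
  have hfg := hknown _ (Finset.mem_insert_self _ _)
  have hC : ∀ h ∈ C, Known F A W y h := fun h hh =>
    hknown h (Finset.mem_insert_of_mem (Finset.mem_union_left _ hh))
  have hD : ∀ h ∈ D, Known F A W y h := fun h hh =>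
    hknown h (Finset.mem_insert_of_mem (Finset.mem_union_right _ hh))
  obtain ⟨a, ha⟩ := exists_canonical F (4 * K ^ 2 + 1) f
  obtain ⟨b, hb⟩ := exists_canonical F (4 * K ^ 2 + 1) g
  by_cases hf : ∀ x, InSubcube W y x → (∀ g ∈ A, g.eval x ≠ 0) → (f - a • F).eval x = 0
  · exact Or.inr (Or.inl (hs.falsifiable_of_excluded hk hF hD hfg hf))
  by_cases hg : ∀ x, InSubcube W y x → (∀ g ∈ A, g.eval x ≠ 0) → (g - b • F).eval x = 0
  · rw [add_comm] at hfg
    exact Or.inl (hs.falsifiable_of_excluded hk hF hC hfg hg)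
  push Not at hf hg
  obtain ⟨x, hx, hxA, hxf⟩ := hf
  obtain ⟨z, hz, hzA, hzg⟩ := hg
  exact Or.inr (Or.inr ⟨hs.falsifiable_insert ha hC hx hxA hxf,
    hs.falsifiable_insert hb hD hz hzA hzg⟩)

theorem Falsifiable.of_simplification {P E : Clause ℚ} (hE : Falsifiable F M k E)
    (hr : IsSimplification P E) : Falsifiable F M k P := by
  obtain ⟨c, hc, rfl⟩ := hr
  obtain ⟨A, W, y, d, hs, hknown⟩ := hE
  refine ⟨A, W, y, d, hs, fun h hh => ?_⟩
  rcases Finset.mem_insert.mp hh with rfl | hh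
  · exact ⟨const 1, Finset.mem_insert_self _ _, c, hc, 0, by simp⟩
  · exact hknown h hh

theorem Falsifiable.of_weakening {P E : Clause ℚ} (hE : Falsifiable F M k E)
    (hr : IsWeakening P E) : Falsifiable F M k P := by
  obtain ⟨f, rfl⟩ := hr
  obtain ⟨A, W, y, d, hs, hknown⟩ := hE
  exact ⟨A, W, y, d, hs, fun h hh => hknown h (Finset.mem_insert_of_mem hh)⟩

/-- Modulo `F`, knowing `F ≠ 0` amounts to knowing `0 ≠ 0`. -/
theorem not_falsifiable_singleton (hk : k ≤ K) (hF : 8 * K ^ 2 + 3 ≤ F.vars.card) :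
    ¬ Falsifiable F (4 * K ^ 2 + 1) k {F} := by
  rintro ⟨A, W, y, d, hs, hknown⟩
  obtain ⟨p, hp, c, hc, a, hx⟩ := hknown F (Finset.mem_singleton_self F)
  refine hs.eval_ne_zero_of_known hk hF (h := const 0) (by simp)
    ⟨p, hp, c, hc, a - 1, fun x hxW => ?_⟩ (by simp)
  rw [eval_const]
  linear_combination hx x hxW

/-- Both disjuncts have a single variable, so if known they would be nonzero at `y`, against `y i`
being 0 or 1. -/
theorem not_falsifiable_boolClause (hk : k ≤ K) (hF : 8 * K ^ 2 + 3 ≤ F.vars.card) (i : ℕ) :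
    ¬ Falsifiable F (4 * K ^ 2 + 1) k (boolClause ℚ i) := by
  rintro ⟨A, W, y, d, hs, hknown⟩
  have h0 := hs.eval_ne_zero_of_known hk hF (h := var i) (by simp)
    (hknown _ (by simp [boolClause]))
  have h1 := hs.eval_ne_zero_of_known hk hF (h := var i - const 1)
    ((Finset.card_le_card (vars_sub_subset _ _)).trans (by simp))
    (hknown _ (by simp [boolClause]))
  rw [eval_sub, eval_var, eval_const] at h1
  rw [eval_var] at h0
  rcases hs.bool i with h | h
  · exact h0 h
  · exact h1 (sub_eq_zero.mpr h)

theorem falsifiable_empty (F : LinPoly ℚ) (M : ℕ) : Falsifiable F M 0 ∅ :=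
  ⟨∅, ∅, fun _ => 0, 0, ⟨by simp, by simp, by simp, by simp, by simp⟩, by simp⟩


/-! ### Counting leaves -/

namespace Derivation

variable {φ : Set (Clause ℚ)} {D : Clause ℚ}

/-- The number of leaves of the tree obtained by unfolding a derivation from a given line. -/
def leaves (π : Derivation φ D) (t : Fin (π.last + 1)) : ℕ :=
  match π.step t with
  | .hypothesis => 1
  | .boolean _ => 1
  -- The test serves termination; the value 0 never occurs, since `π.justified` makes premises
  -- earlier.
  | .resolution j k => if _h : j < t ∧ k < t then leaves π j + leaves π k else 0
  | .simplification j => if _h : j < t then leaves π j else 0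
  | .weakening j => if _h : j < t then leaves π j else 0
termination_by t
decreasing_by all_goals first | exact _h.1 | exact _h.2 | exact _h

/-- The indicator of the lines that are hypotheses or boolean clauses. -/
def isLeaf (π : Derivation φ D) (t : Fin (π.last + 1)) : ℕ :=
  match π.step t with
  | .hypothesis => 1
  | .boolean _ => 1
  | _ => 0

theorem lt_of_mem_premises (π : Derivation φ D) {j t : Fin (π.last + 1)}
    (h : j ∈ (π.step t).premises) : j < t := by
  have hj := π.justified t
  cases hst : π.step t <;> rw [hst] at h hj <;>
    simp only [Step.premises, List.mem_cons, List.not_mem_nil, or_false, Step.Justifies] at h hj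
  · rcases h with rfl | rfl
    exacts [hj.1, hj.2.1]
  · exact h ▸ hj.1
  · exact h ▸ hj.1

theorem leaves_eq (π : Derivation φ D) (t : Fin (π.last + 1)) :
    π.leaves t = π.isLeaf t + ∑ j, (π.step t).premises.count j * π.leaves j := by
  have hj := π.justified t
  rw [leaves, isLeaf]
  cases hst : π.step t <;> rw [hst] at hj <;> simp only [Step.Justifies] at hj
  · simp [Step.premises]
  · simp [Step.premises]
  · simp [Step.premises, List.count_cons, add_mul, Finset.sum_add_distrib, hj.1, hj.2.1, add_comm]
  · simp [Step.premises, List.count_cons, hj.1]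
  · simp [Step.premises, List.count_cons, hj.1]

/-- Sum `leaves_eq` over all lines: each line other than the last reappears at most once on the
right and cancels, while the last is never a premise. -/
theorem TreeLike.leaves_le (π : Derivation φ D) (hπ : π.TreeLike) :
    π.leaves (Fin.last _) ≤ ∑ t, π.isLeaf t := by
  have h1 : ∑ t, π.leaves t = ∑ t, π.isLeaf t +
      ∑ j, (∑ t, (π.step t).premises.count j) * π.leaves j := by
    rw [Finset.sum_congr rfl fun t _ => π.leaves_eq t, Finset.sum_add_distrib, Finset.sum_comm]
    simp only [Finset.sum_mul]
  have h2 : ∑ t, (π.step t).premises.count (Fin.last π.last) = 0 :=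
    Finset.sum_eq_zero fun t _ => List.count_eq_zero.mpr fun h =>
      absurd (π.lt_of_mem_premises h) (not_lt.mpr (Fin.le_last t))
  rw [Fin.sum_univ_castSucc, Fin.sum_univ_castSucc (fun j => _ * π.leaves j), h2, zero_mul,
    add_zero] at h1
  have h3 : ∑ j : Fin π.last, (∑ t, (π.step t).premises.count j.castSucc) * π.leaves j.castSucc ≤
      ∑ j : Fin π.last, π.leaves j.castSucc :=
    Finset.sum_le_sum fun j _ => (Nat.mul_le_mul_right _ (hπ _)).trans (one_mul _).le
  omega

theorem leaves_pos (π : Derivation φ D) (t : Fin (π.last + 1)) : 1 ≤ π.leaves t := by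
  induction t using WellFoundedLT.induction with
  | ind t ih =>
    have hj := π.justified t
    rw [leaves]
    cases hst : π.step t <;> rw [hst] at hj <;> simp only [Step.Justifies] at hj <;> simp only
    · rw [dif_pos ⟨hj.1, hj.2.1⟩]
      exact (ih _ hj.1).trans (Nat.le_add_right _ _)
    · rw [dif_pos hj.1]
      exact ih _ hj.1
    · rw [dif_pos hj.1]
      exact ih _ hj.1

end Derivation

/-- Each binary choice doubles the count and spends one of the `K - k` choices left; free moves keep
the bound along one premise. -/
theorem two_pow_le_leaves {F : LinPoly ℚ} {K : ℕ} (hF : 8 * K ^ 2 + 3 ≤ F.vars.card)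
    {D : Clause ℚ} (π : Derivation {{F}} D) (t : Fin (π.last + 1)) :
    ∀ k ≤ K, Falsifiable F (4 * K ^ 2 + 1) k (π.line t) → 2 ^ (K - k) ≤ π.leaves t := by
  induction t using WellFoundedLT.induction with
  | ind t ih =>
    intro k hk hfal
    have hj := π.justified t
    rw [Derivation.leaves]
    cases hst : π.step t with
    | hypothesis =>
      rw [hst] at hj
      rw [show π.line t = {F} from hj] at hfal
      exact (not_falsifiable_singleton hk hF hfal).elim
    | boolean i =>
      rw [hst] at hj
      rw [show π.line t = boolClause ℚ i from hj] at hfal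
      exact (not_falsifiable_boolClause hk hF i hfal).elim
    | resolution i j =>
      rw [hst] at hj
      obtain ⟨hi, hj, hr⟩ := hj
      simp only
      rw [dif_pos ⟨hi, hj⟩]
      rcases hfal.of_resolution hk hF hr with h | h | ⟨h1, h2⟩
      · exact (ih i hi k hk h).trans (Nat.le_add_right _ _)
      · exact (ih j hj k hk h).trans (Nat.le_add_left _ _)
      · rcases hk.eq_or_lt with rfl | hlt
        · rw [Nat.sub_self, pow_zero]
          exact (π.leaves_pos i).trans (Nat.le_add_right _ _)
        · have e : K - k = (K - (k + 1)) + 1 := by omega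
          rw [e, pow_succ, mul_two]
          exact Nat.add_le_add (ih i hi _ hlt h1) (ih j hj _ hlt h2)
    | simplification j =>
      rw [hst] at hj
      simp only
      rw [dif_pos hj.1]
      exact ih j hj.1 k hk (hfal.of_simplification hj.2)
    | weakening j =>
      rw [hst] at hj
      simp only
      rw [dif_pos hj.1]
      exact ih j hj.1 k hk (hfal.of_weakening hj.2)

theorem one_le_coeffSize (q : ℚ) : 1 ≤ coeffSize q :=
  (le_max_left 1 _).trans (Nat.le_add_right _ _)

theorem Clause.card_vars_add_one_le_size {C : Clause ℚ} {f : LinPoly ℚ} (hf : f ∈ C) :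
    f.vars.card + 1 ≤ C.size := by
  have h1 : f.vars.card + f.coeffsSize ≤ C.size :=
    Finset.single_le_sum (f := fun g : LinPoly ℚ => g.vars.card + g.coeffsSize)
      (fun _ _ => Nat.zero_le _) hf
  have h2 : 1 ≤ f.coeffsSize := (one_le_coeffSize f.2).trans (Nat.le_add_left _ _)
  omega

/-- Leaf clauses have size at least 2, except that `{F}` may have size 1 when `F` is constant; hence
the parameter `m`. -/
theorem Derivation.mul_sum_isLeaf_le_size {F : LinPoly ℚ} {D : Clause ℚ}
    (π : Derivation {{F}} D) {m : ℕ} (hm : m ≤ 2) (hF : m ≤ F.vars.card + 1) :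
    m * ∑ t, π.isLeaf t ≤ π.size := by
  rw [Finset.mul_sum]
  refine Finset.sum_le_sum fun t _ => ?_
  have hj := π.justified t
  rw [isLeaf]
  cases hst : π.step t <;> rw [hst] at hj <;> simp only [mul_one, mul_zero, Nat.zero_le]
  · rw [show π.line t = {F} from hj]
    exact hF.trans (Clause.card_vars_add_one_le_size (Finset.mem_singleton_self F))
  · rename_i i
    rw [show π.line t = boolClause ℚ i from hj]
    refine hm.trans (le_trans ?_ (Clause.card_vars_add_one_le_size (f := var i)
      (by simp [boolClause])))
    simp

end ResLin

theorem mainTheorem2 :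
    ∃ c : ℝ, 0 < c ∧
      ∀ (n : ℕ) (f : ResLin.LinPoly ℚ), f.vars.card = n → (0 : ℚ) ∉ f.im2 →
        ∀ π : ResLin.Refutation ({{f}} : Set (ResLin.Clause ℚ)), π.TreeLike →
          (2 : ℝ) ^ (c * Real.sqrt (n : ℝ)) ≤ (π.size : ℝ) := by
  refine ⟨1 / 4, by norm_num, fun n f hn _ π hπ => ?_⟩
  have hleaves := ResLin.Derivation.TreeLike.leaves_le π hπ
  rcases Nat.eq_zero_or_pos n with rfl | hpos
  · have h1 := π.mul_sum_isLeaf_le_size (m := 1) (by omega) (by omega)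
    have h2 := π.leaves_pos (Fin.last _)
    have h3 : 1 ≤ π.size := by omega
    simpa using h3
  -- For `K ≥ 1`, `8K ^ 2 + 3 ≤ 16K ^ 2 ≤ n`. The factor 2 from the leaf sizes makes up for rounding
  -- down.
  set K := ⌊1 / 4 * Real.sqrt (n : ℝ)⌋₊ with hK
  have hsq : 0 ≤ 1 / 4 * Real.sqrt (n : ℝ) := by positivity
  have hKn : 16 * K ^ 2 ≤ n := by
    have h1 : (K : ℝ) ≤ 1 / 4 * Real.sqrt n := Nat.floor_le hsq
    have h2 := Real.sq_sqrt (Nat.cast_nonneg (α := ℝ) n)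
    have h3 : (16 * K ^ 2 : ℝ) ≤ n := by nlinarith [Nat.cast_nonneg (α := ℝ) K]
    exact_mod_cast h3
  have hpow : 2 ^ K ≤ π.leaves (Fin.last _) := by
    rcases Nat.eq_zero_or_pos K with h0 | h0
    · rw [h0, pow_zero]
      exact π.leaves_pos _
    · have := ResLin.two_pow_le_leaves (F := f) (K := K) (by rw [hn]; nlinarith) π (Fin.last _) 0
        (Nat.zero_le _) (by rw [π.line_last]; exact ResLin.falsifiable_empty _ _)
      simpa using this
  have hsize : 2 ^ (K + 1) ≤ π.size := by
    have := π.mul_sum_isLeaf_le_size (m := 2) le_rfl (by omega)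
    rw [pow_succ]
    omega
  calc (2 : ℝ) ^ (1 / 4 * Real.sqrt (n : ℝ)) ≤ (2 : ℝ) ^ ((K + 1 : ℕ) : ℝ) := by
        refine Real.rpow_le_rpow_of_exponent_le one_le_two ?_
        push_cast
        exact (Nat.lt_floor_add_one _).le
    _ = ((2 ^ (K + 1) : ℕ) : ℝ) := by rw [Real.rpow_natCast]; push_cast; rfl
    _ ≤ π.size := by exact_mod_cast hsize
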